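/- Let $t\in\{3,4\}$ and let $n\ge t$ be an integer. An orthogonal array $OA(t,n)$ is a $t\times n^2$ matrix with entries from $\{1,\dots,n\}$ such that, for any two distinct rows, the $n^2$ ordered pairs they define are all distinct. Its associated graph has the $n^2$ columns as vertices, two distinct columns being adjacent if they have the same entry in some coordinate position. Then for every orthogonal array $OA(t,n)$ the associated graph $G$ is a connected strongly regular graph with parameters $$(v,k,\lambda,\mu)=\bigl(n^2,\;t(n-1),\;n-2+(t-1)(t-2),\;t(t-1)\bigr),$$ and it satisfies Brouwer's conjecture: either there is no set $S$ of vertices such that $G\setminus S$ is disconnected and each of its components has at least two vertices, or the minimum size of such a set $S$ is exactly $2k-\lambda-2$. -/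

import Mathlib

/-- `A` is an orthogonal array `OA(t,n)`: a `t × n²` matrix with entries from an `n`-element set such
that, for any two distinct rows, the `n²` ordered pairs formed by them are all distinct. -/
def IsOrthogonalArray (t n : ℕ) (A : Matrix (Fin t) (Fin (n ^ 2)) (Fin n)) : Prop :=
  ∀ i j : Fin t, i ≠ j → Function.Injective fun c : Fin (n ^ 2) => (A i c, A j c)

/-- The graph of an array: vertices are the columns, two distinct columns being adjacent if they have
the same entry in some coordinate position. -/
def orthogonalArrayGraph {t n : ℕ} (A : Matrix (Fin t) (Fin (n ^ 2)) (Fin n)) :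
    SimpleGraph (Fin (n ^ 2)) where
  Adj c d := c ≠ d ∧ ∃ i : Fin t, A i c = A i d
  symm := ⟨fun _ _ h => ⟨h.1.symm, h.2.imp fun _ hi => hi.symm⟩⟩
  loopless := ⟨fun _ h => h.1 rfl⟩

instance orthogonalArrayGraph.decidableRelAdj {t n : ℕ} (A : Matrix (Fin t) (Fin (n ^ 2)) (Fin n)) :
    DecidableRel (orthogonalArrayGraph A).Adj := fun c d =>
  inferInstanceAs (Decidable (c ≠ d ∧ ∃ i : Fin t, A i c = A i d))

/-- Removing the vertex set `S` disconnects `G` (at least two components remain), and every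
component that remains has at least two vertices. -/
def DisconnectsIntoNonSingletons {V : Type*} (G : SimpleGraph V) (S : Finset V) : Prop :=
  ¬ (G.induce {x : V | x ∉ S}).Preconnected ∧
    ∀ c : (G.induce {x : V | x ∉ S}).ConnectedComponent, 2 ≤ c.supp.ncard

/-- `G` is a connected `(v,k,l,m)`-strongly regular graph for which Brouwer's conjecture holds:
either no vertex set disconnects it into non-singleton components, or the minimum size of such a set
is `2k - l - 2`. -/
structure SatisfiesBrouwerConjecture {V : Type*} [Fintype V] (G : SimpleGraph V)
    [DecidableRel G.Adj] (v k l m : ℕ) : Prop where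
  isSRG : G.IsSRGWith v k l m
  connected : G.Connected
  ok : (¬ ∃ S : Finset V, DisconnectsIntoNonSingletons G S) ∨
    IsLeast {s : ℤ | ∃ S : Finset V, DisconnectsIntoNonSingletons G S ∧ (S.card : ℤ) = s}
      (2 * (k : ℤ) - (l : ℤ) - 2)

/-!
Let `X` and `Y` be nonempty sets of columns without edges between them, and let `m(x)` be the number
of coordinates in which the entry of the column `x` occurs in `X`; so `m = t` on `X` and `m = 0` on
`Y`. Since two rows show each pair of entries exactly once, the sums of `m` and of `m ^ 2` over all
columns depend only on the numbers of entries of `X` in the `t` coordinates. Summing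
`(m - a) * (m - (a + 1)) ≥ 0` for suitable integers `a` bounds `#X + #Y` in terms of the total
number of entries of `X`. When both sides contain an edge and `t ≤ 4`, this bound is at most the
value attained by an edge `{u, v}` against the set of vertices far from it (adjacent to neither
`u` nor `v`). The exceptions are `t = 4`, `n ≤ 5`, where each side is small because it is far from
an edge of the other.

Conversely, deleting all other neighbours of `u` and `v` produces two admissible sides as soon as no
far vertex `w` is isolated among the far vertices. For `n ≥ 2 * t - 1`, a line through `w` (the `n`
columns with a prescribed entry in one coordinate) has at most `2 * t - 3` incidences with entries
of `u` and `v`, hence contains another far vertex. If there are at most two far vertices, they form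
the side opposite to any side containing `u` and `v`. Only `t = 4`, `n = 6` remains: with `m`
counting the entries of `{w, u, v}`, an isolated `w` would force `m` to be odd somewhere on each
line of one direction, making `∑ x, (m x - 2) ^ 2` too large.
-/

open Finset

section Splits

variable {V : Type*} {G : SimpleGraph V} {X Y S : Finset V}

/-- Every vertex of `X` has a neighbour in `X`, that is, the subgraph induced on `X` has no
component with a single vertex. -/
def HasNoIsolatedVertex (G : SimpleGraph V) (X : Finset V) : Prop :=
  ∀ x ∈ X, ∃ y ∈ X, G.Adj x y

/-- A partition `X ∪ Y` of the vertices left over by a disconnecting set, with no edge across and no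
singleton component on either side; the disconnecting set itself is recovered as `(X ∪ Y)ᶜ`. -/
structure IsSplit (G : SimpleGraph V) (X Y : Finset V) : Prop where
  disjoint : Disjoint X Y
  nonempty_left : X.Nonempty
  nonempty_right : Y.Nonempty
  not_adj : ∀ x ∈ X, ∀ y ∈ Y, ¬ G.Adj x y
  noIsolated_left : HasNoIsolatedVertex G X
  noIsolated_right : HasNoIsolatedVertex G Y

namespace IsSplit

lemma symm (h : IsSplit G X Y) : IsSplit G Y X where
  disjoint := h.disjoint.symm
  nonempty_left := h.nonempty_right
  nonempty_right := h.nonempty_left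
  not_adj y hy x hx hyx := h.not_adj x hx y hy hyx.symm
  noIsolated_left := h.noIsolated_right
  noIsolated_right := h.noIsolated_left

lemma exists_adj_left (h : IsSplit G X Y) : ∃ u ∈ X, ∃ v ∈ X, G.Adj u v :=
  let ⟨u, hu⟩ := h.nonempty_left
  ⟨u, hu, h.noIsolated_left u hu⟩

lemma two_le_card_left (h : IsSplit G X Y) : 2 ≤ #X := by
  obtain ⟨u, hu, v, hv, huv⟩ := h.exists_adj_left
  exact one_lt_card.2 ⟨u, hu, v, hv, huv.ne⟩

end IsSplit

lemma two_le_ncard_supp_iff_exists_adj [Finite V] (G : SimpleGraph V) (v : V) :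
    2 ≤ (G.connectedComponentMk v).supp.ncard ↔ ∃ w, G.Adj v w := by
  constructor
  · intro h
    obtain ⟨w, hw, hne⟩ := Set.exists_ne_of_one_lt_ncard h v
    obtain ⟨p⟩ : G.Reachable v w := (SimpleGraph.ConnectedComponent.exact hw).symm
    cases p with
    | nil => exact absurd rfl hne
    | cons hadj _ => exact ⟨_, hadj⟩
  · rintro ⟨w, hvw⟩
    exact (Set.one_lt_ncard (Set.toFinite _)).2
      ⟨v, rfl, w, SimpleGraph.ConnectedComponent.sound hvw.symm.reachable, hvw.ne⟩

variable [Fintype V] [DecidableEq V]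

lemma DisconnectsIntoNonSingletons.exists_isSplit (h : DisconnectsIntoNonSingletons G S) :
    ∃ X Y : Finset V, IsSplit G X Y ∧ X ∪ Y = Sᶜ := by
  classical
  obtain ⟨hpre, hcomp⟩ := h
  set H := G.induce {v : V | v ∉ S}
  obtain ⟨x, y, hxy⟩ : ∃ x y, ¬ H.Reachable x y := by
    simpa only [SimpleGraph.Preconnected, not_forall] using hpre
  have hadj : ∀ v : {v : V | v ∉ S}, ∃ w, H.Adj v w := fun v =>
    (two_le_ncard_supp_iff_exists_adj H v).1 (hcomp _)
  let X : Finset V := {v | ∃ hv : v ∉ S, H.Reachable x ⟨v, hv⟩}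
  let Y : Finset V := {v | ∃ hv : v ∉ S, ¬ H.Reachable x ⟨v, hv⟩}
  have mem_X {v} : v ∈ X ↔ ∃ hv : v ∉ S, H.Reachable x ⟨v, hv⟩ := mem_filter_univ v
  have mem_Y {v} : v ∈ Y ↔ ∃ hv : v ∉ S, ¬ H.Reachable x ⟨v, hv⟩ := mem_filter_univ v
  refine ⟨X, Y, ⟨?_, ⟨x, mem_X.2 ⟨x.2, .refl _⟩⟩, ⟨y, mem_Y.2 ⟨y.2, hxy⟩⟩, ?_, ?_, ?_⟩, ?_⟩
  · refine disjoint_left.2 fun v hX hY => ?_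
    exact (mem_Y.1 hY).2 (mem_X.1 hX).2
  · intro v hv w hw hvw
    obtain ⟨hvS, hxv⟩ := mem_X.1 hv
    obtain ⟨hwS, hxw⟩ := mem_Y.1 hw
    have hvw' : H.Adj ⟨v, hvS⟩ ⟨w, hwS⟩ := hvw
    exact hxw (hxv.trans hvw'.reachable)
  · intro v hv
    obtain ⟨hvS, hxv⟩ := mem_X.1 hv
    obtain ⟨w, hvw⟩ := hadj ⟨v, hvS⟩
    exact ⟨w, mem_X.2 ⟨w.2, hxv.trans hvw.reachable⟩, hvw⟩
  · intro v hv
    obtain ⟨hvS, hxv⟩ := mem_Y.1 hv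
    obtain ⟨w, hvw⟩ := hadj ⟨v, hvS⟩
    exact ⟨w, mem_Y.2 ⟨w.2, fun hxw => hxv (hxw.trans hvw.symm.reachable)⟩, hvw⟩
  · ext v
    rw [mem_union, mem_X, mem_Y, ← exists_or, mem_compl]
    exact ⟨fun ⟨hv, _⟩ => hv, fun hv => ⟨hv, em _⟩⟩

lemma IsSplit.disconnectsIntoNonSingletons (h : IsSplit G X Y) :
    DisconnectsIntoNonSingletons G (X ∪ Y)ᶜ := by
  have hmem : ∀ v, v ∉ (X ∪ Y)ᶜ ↔ v ∈ X ∨ v ∈ Y := fun v => by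
    rw [notMem_compl, mem_union]
  constructor
  · intro hpre
    obtain ⟨x, hx⟩ := h.nonempty_left
    obtain ⟨y, hy⟩ := h.nonempty_right
    obtain ⟨p⟩ := hpre ⟨x, (hmem x).2 (.inl hx)⟩ ⟨y, (hmem y).2 (.inr hy)⟩
    obtain ⟨d, -, hd, hd'⟩ :=
      p.exists_boundary_dart {v | (v : V) ∈ X} hx (disjoint_right.1 h.disjoint hy)
    exact h.not_adj _ hd _ (((hmem _).1 d.snd.2).resolve_left hd') d.adj
  · intro c
    induction c using SimpleGraph.ConnectedComponent.ind with
    | h v =>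
      rw [two_le_ncard_supp_iff_exists_adj]
      rcases (hmem v).1 v.2 with hv | hv
      · obtain ⟨w, hw, hvw⟩ := h.noIsolated_left _ hv
        exact ⟨⟨w, (hmem w).2 (.inl hw)⟩, hvw⟩
      · obtain ⟨w, hw, hvw⟩ := h.noIsolated_right _ hv
        exact ⟨⟨w, (hmem w).2 (.inr hw)⟩, hvw⟩

lemma IsSplit.card_compl_union_add (h : IsSplit G X Y) :
    #(X ∪ Y)ᶜ + (#X + #Y) = Fintype.card V := by
  rw [← card_union_of_disjoint h.disjoint, card_compl_add_card]

end Splits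

section StronglyRegular

variable {V : Type*} [Fintype V] {G : SimpleGraph V} [DecidableRel G.Adj]
  {v k l m : ℕ} {x y : V} {X Y : Finset V}

lemma connected_of_isSRGWith [Nonempty V] (hG : G.IsSRGWith v k l m) (hm : m ≠ 0) :
    G.Connected := by
  refine (SimpleGraph.connected_iff G).2 ⟨fun x y => ?_, inferInstance⟩
  by_cases hxy : x = y
  · exact hxy ▸ .refl x
  by_cases hadj : G.Adj x y
  · exact hadj.reachable
  obtain ⟨z, hz⟩ : Nonempty (G.commonNeighbors x y) := by
    rw [← Fintype.card_pos_iff, hG.of_not_adj hxy hadj]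
    exact Nat.pos_of_ne_zero hm
  rw [SimpleGraph.mem_commonNeighbors] at hz
  exact hz.1.reachable.trans hz.2.symm.reachable

variable [DecidableEq V]

variable (G) in
/-- The vertices adjacent to neither `x` nor `y`. For an edge `xy` these are what is left after
deleting `x`, `y` and all their neighbours. -/
def farVertices (x y : V) : Finset V := (G.neighborFinset x ∪ G.neighborFinset y)ᶜ

lemma mem_farVertices {z : V} : z ∈ farVertices G x y ↔ ¬ G.Adj x z ∧ ¬ G.Adj y z := by
  simp [farVertices]

lemma card_farVertices_add (hG : G.IsSRGWith v k l m) (hxy : G.Adj x y) :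
    #(farVertices G x y) + 2 * k = v + l := by
  have hunion : #(G.neighborFinset x ∪ G.neighborFinset y) = 2 * k - l :=
    hG.card_neighborFinset_union_of_adj hxy
  have hcompl := card_compl_add_card (G.neighborFinset x ∪ G.neighborFinset y)
  have hlk : l < k := hG.of_adj x y hxy ▸ hG.regular x ▸ hxy.card_commonNeighbors_lt_degree
  rw [hunion, hG.card] at hcompl
  rw [farVertices]
  omega

lemma isSplit_pair_farVertices (hxy : G.Adj x y) (hne : (farVertices G x y).Nonempty)
    (h : HasNoIsolatedVertex G (farVertices G x y)) :
    IsSplit G {x, y} (farVertices G x y) where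
  disjoint := by simp [mem_farVertices, hxy, hxy.symm]
  nonempty_left := insert_nonempty x {y}
  nonempty_right := hne
  not_adj := by simp +contextual [mem_farVertices]
  noIsolated_left := by simp [HasNoIsolatedVertex, hxy, hxy.symm]
  noIsolated_right := h

lemma IsSplit.right_subset_farVertices (h : IsSplit G X Y) (hx : x ∈ X) (hy : y ∈ X) :
    Y ⊆ farVertices G x y :=
  fun z hz => mem_farVertices.2 ⟨h.not_adj x hx z hz, h.not_adj y hy z hz⟩

/-- A disconnecting set of the conjectured size is the set of vertices outside an edge `xy` that are
adjacent to `x` or to `y`; its split is `{x, y}` against the far vertices. -/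
lemma satisfiesBrouwerConjecture_of_isSplit_bounds (hG : G.IsSRGWith v k l m)
    (hconn : G.Connected)
    (hle : ∀ X Y x y, IsSplit G X Y → G.Adj x y → #X + #Y ≤ #(farVertices G x y) + 2)
    (hex : ∀ X Y, IsSplit G X Y →
      ∃ x y, G.Adj x y ∧ IsSplit G {x, y} (farVertices G x y)) :
    SatisfiesBrouwerConjecture G v k l m := by
  refine ⟨hG, hconn, or_iff_not_imp_left.2 fun hS => ?_⟩
  obtain ⟨S, hS⟩ := not_not.1 hS
  obtain ⟨X, Y, hXY, -⟩ := hS.exists_isSplit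
  obtain ⟨x, y, hxy, hsplit⟩ := hex X Y hXY
  have hfar := card_farVertices_add hG hxy
  refine ⟨⟨_, hsplit.disconnectsIntoNonSingletons, ?_⟩, ?_⟩
  · have hcard := hsplit.card_compl_union_add
    rw [card_pair hxy.ne, hG.card] at hcard
    omega
  · rintro s ⟨S', hS', rfl⟩
    obtain ⟨X', Y', hsplit', hXY'⟩ := hS'.exists_isSplit
    have hbound := hle X' Y' x y hsplit' hxy
    have hcard := hsplit'.card_compl_union_add
    rw [hXY', compl_compl, hG.card] at hcard
    omega

end StronglyRegular

section Columns

variable {t n : ℕ} {A : Matrix (Fin t) (Fin (n ^ 2)) (Fin n)} {R : Fin t → Finset (Fin n)}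
  {i : Fin t} {c x y : Fin (n ^ 2)} {X Y : Finset (Fin (n ^ 2))}

/-- The number of coordinates `i` in which the column `x` has its entry in the prescribed set
`R i`. -/
def hits (A : Matrix (Fin t) (Fin (n ^ 2)) (Fin n)) (R : Fin t → Finset (Fin n))
    (x : Fin (n ^ 2)) : ℕ := #{i | A i x ∈ R i}

lemma hits_eq_zero_iff : hits A R x = 0 ↔ ∀ i, A i x ∉ R i := by
  simp [hits, filter_eq_empty_iff]

lemma sum_hits_mul_eq_sum_lines (w : Fin (n ^ 2) → ℕ) :
    ∑ x, hits A R x * w x = ∑ i, ∑ a ∈ R i, ∑ x with A i x = a, w x := by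
  simp only [hits, card_filter, sum_mul, ite_mul, one_mul, zero_mul]
  rw [sum_comm]
  refine sum_congr rfl fun i _ => ?_
  rw [sum_fiberwise_eq_sum_filter, sum_filter]

/-- The entries that the columns of `X` have in coordinate `i`. -/
def entries (A : Matrix (Fin t) (Fin (n ^ 2)) (Fin n)) (X : Finset (Fin (n ^ 2)))
    (i : Fin t) : Finset (Fin n) := X.image (A i)

lemma mem_entries_of_mem (hx : x ∈ X) (i : Fin t) : A i x ∈ entries A X i :=
  mem_image_of_mem (A i) hx

lemma entries_mono (hXY : X ⊆ Y) (i : Fin t) : entries A X i ⊆ entries A Y i :=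
  image_subset_image hXY

lemma entries_singleton (A : Matrix (Fin t) (Fin (n ^ 2)) (Fin n)) (c : Fin (n ^ 2)) :
    entries A {c} i = {A i c} := image_singleton (A i) c

lemma entries_insert :
    entries A (insert x X) i = insert (A i x) (entries A X i) := image_insert (A i) x X

lemma hits_entries_of_mem (hx : x ∈ X) : hits A (entries A X) x = t := by
  simp [hits, mem_entries_of_mem hx]

lemma hits_entries_eq_zero (hy : y ∉ X) (h : ∀ x ∈ X, ¬ (orthogonalArrayGraph A).Adj x y) :
    hits A (entries A X) y = 0 := by
  refine hits_eq_zero_iff.2 fun i hi => ?_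
  obtain ⟨x, hx, hxy⟩ := mem_image.1 hi
  exact h x hx ⟨fun he => hy (he ▸ hx), i, hxy⟩

lemma mem_farVertices_iff_hits_eq_zero (hxy : (orthogonalArrayGraph A).Adj x y) :
    c ∈ farVertices (orthogonalArrayGraph A) x y ↔ hits A (entries A {x, y}) c = 0 := by
  rw [mem_farVertices]
  constructor
  · rintro ⟨hx, hy⟩
    refine hits_entries_eq_zero ?_ ?_
    · rw [mem_insert, mem_singleton]
      rintro (rfl | rfl)
      exacts [hy hxy.symm, hx hxy]
    · simp [hx, hy]
  · intro h
    have hmem := hits_eq_zero_iff.1 h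
    exact ⟨fun ⟨_, i, hi⟩ => hmem i (hi ▸ mem_entries_of_mem (by simp) i),
      fun ⟨_, i, hi⟩ => hmem i (hi ▸ mem_entries_of_mem (by simp) i)⟩

lemma IsSplit.disjoint_entries (h : IsSplit (orthogonalArrayGraph A) X Y) (i : Fin t) :
    Disjoint (entries A X i) (entries A Y i) := by
  refine disjoint_left.2 fun a haX haY => ?_
  obtain ⟨x, hx, rfl⟩ := mem_image.1 haX
  obtain ⟨y, hy, hyx⟩ := mem_image.1 haY
  exact h.not_adj x hx y hy ⟨fun he => disjoint_left.1 h.disjoint hx (he ▸ hy), i, hyx.symm⟩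

/-- The number of pairs consisting of a coordinate and an entry of `X` in that coordinate: the
parameter in which the size of a split is bounded. -/
def entryCount (A : Matrix (Fin t) (Fin (n ^ 2)) (Fin n)) (X : Finset (Fin (n ^ 2))) : ℕ :=
  ∑ i, #(entries A X i)

lemma entryCount_mono (hXY : X ⊆ Y) : entryCount A X ≤ entryCount A Y :=
  sum_le_sum fun i _ => card_le_card (entries_mono hXY i)

lemma entryCount_sq_le (A : Matrix (Fin t) (Fin (n ^ 2)) (Fin n)) (X : Finset (Fin (n ^ 2))) :
    entryCount A X ^ 2 ≤ t * ∑ i, #(entries A X i) ^ 2 := by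
  simpa [entryCount] using
    sq_sum_le_card_mul_sum_sq (s := univ) (f := fun i => #(entries A X i))

lemma entryCount_add_entryCount_le (hXY : ∀ i, Disjoint (entries A X i) (entries A Y i)) :
    entryCount A X + entryCount A Y ≤ t * n :=
  calc entryCount A X + entryCount A Y = ∑ i, #(entries A X i ∪ entries A Y i) := by
        simp only [entryCount, ← sum_add_distrib, card_union_of_disjoint (hXY _)]
    _ ≤ ∑ _i : Fin t, n := sum_le_sum fun i _ => card_le_univ _ |>.trans_eq (Fintype.card_fin n)
    _ = t * n := by simp

lemma two_mul_card_image_add_card_le {α β : Type*} [DecidableEq β] {f : α → β}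
    {s D : Finset α} (hDs : D ⊆ s) (hD : ∀ x ∈ D, ∃ y ∈ D, x ≠ y ∧ f x = f y) :
    2 * #(s.image f) + #D ≤ 2 * #s := by
  classical
  have himageD : 2 * #(D.image f) ≤ #D := by
    refine mul_card_image_le_card _ 2 fun b hb => ?_
    obtain ⟨x, hx, rfl⟩ := mem_image.1 hb
    obtain ⟨y, hy, hne, hxy⟩ := hD x hx
    exact one_lt_card.2 ⟨x, mem_filter.2 ⟨hx, rfl⟩, y, mem_filter.2 ⟨hy, hxy.symm⟩, hne⟩
  have himage : #(s.image f) ≤ #(s \ D) + #(D.image f) := by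
    conv_lhs => rw [← sdiff_union_of_subset hDs, image_union]
    exact (card_union_le _ _).trans (Nat.add_le_add_right card_image_le _)
  have hsdiff : #(s \ D) + #D = #s := card_sdiff_add_card_eq_card hDs
  omega

lemma HasNoIsolatedVertex.two_mul_entryCount_add_card_le
    (h : HasNoIsolatedVertex (orthogonalArrayGraph A) X) :
    2 * entryCount A X + #X ≤ t * (2 * #X) := by
  let D (i : Fin t) : Finset (Fin (n ^ 2)) := {x ∈ X | ∃ y ∈ X, x ≠ y ∧ A i x = A i y}
  have hX : X ⊆ univ.biUnion D := by
    intro x hx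
    obtain ⟨y, hy, hne, i, hi⟩ := h x hx
    exact mem_biUnion.2 ⟨i, mem_univ i, mem_filter.2 ⟨hx, y, hy, hne, hi⟩⟩
  have hD (i : Fin t) : 2 * #(entries A X i) + #(D i) ≤ 2 * #X := by
    refine two_mul_card_image_add_card_le (filter_subset _ X) fun x hx => ?_
    obtain ⟨hxX, y, hy, hne, hxy⟩ := mem_filter.1 hx
    exact ⟨y, mem_filter.2 ⟨hy, x, hxX, hne.symm, hxy.symm⟩, hne, hxy⟩
  calc 2 * entryCount A X + #X ≤ 2 * entryCount A X + ∑ i, #(D i) := by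
        gcongr
        exact (card_le_card hX).trans card_biUnion_le
    _ = ∑ i, (2 * #(entries A X i) + #(D i)) := by rw [entryCount, mul_sum, ← sum_add_distrib]
    _ ≤ ∑ _i : Fin t, 2 * #X := sum_le_sum fun i _ => hD i
    _ = t * (2 * #X) := by simp

end Columns

namespace IsOrthogonalArray

variable {t n : ℕ} {A : Matrix (Fin t) (Fin (n ^ 2)) (Fin n)} {R : Fin t → Finset (Fin n)}
  {i j : Fin t} {c d u v w : Fin (n ^ 2)} {X Y : Finset (Fin (n ^ 2))}

lemma bijective (hA : IsOrthogonalArray t n A) (hij : i ≠ j) :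
    Function.Bijective fun c => (A i c, A j c) :=
  (Fintype.bijective_iff_injective_and_card _).2 ⟨hA i j hij, by simp [sq]⟩

lemma card_filter_eq_and_mem (hA : IsOrthogonalArray t n A) (hij : i ≠ j) (a : Fin n)
    (s : Finset (Fin n)) : #{x | A i x = a ∧ A j x ∈ s} = #s := by
  rw [← one_mul #s, ← card_singleton a, ← card_product]
  refine card_nbij (fun x => (A i x, A j x)) (fun x hx => by simpa [eq_comm, and_comm] using hx)
    (hA i j hij).injOn fun p hp => ?_
  obtain ⟨x, rfl⟩ := (hA.bijective hij).2 p
  exact ⟨x, by simpa [eq_comm, and_comm] using hp, rfl⟩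

lemma card_filter_eq (hA : IsOrthogonalArray t n A) (ht : 2 ≤ t) (i : Fin t) (a : Fin n) :
    #{x | A i x = a} = n := by
  have : Nontrivial (Fin t) := Fin.nontrivial_iff_two_le.2 ht
  obtain ⟨j, hj⟩ := exists_ne i
  simpa using hA.card_filter_eq_and_mem hj.symm a univ

lemma sum_line_hits_add (hA : IsOrthogonalArray t n A) (ht : 2 ≤ t)
    (R : Fin t → Finset (Fin n)) (i : Fin t) (a : Fin n) :
    ∑ x with A i x = a, hits A R x + #(R i) = (if a ∈ R i then n else 0) + ∑ j, #(R j) := by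
  have hline : ∑ x with A i x = a, hits A R x = ∑ j, #{x | A i x = a ∧ A j x ∈ R j} := by
    simp only [hits, card_filter, sum_filter, ← ite_and, ite_sum_zero]
    rw [sum_comm]
  have hself : #{x | A i x = a ∧ A i x ∈ R i} = if a ∈ R i then n else 0 := by
    rw [filter_congr fun x _ => and_congr_right fun hx => by rw [hx]]
    split_ifs with ha <;> simp [ha, hA.card_filter_eq ht i a]
  have hother : ∑ j ∈ univ.erase i, #{x | A i x = a ∧ A j x ∈ R j} = ∑ j ∈ univ.erase i, #(R j) :=
    sum_congr rfl fun j hj => hA.card_filter_eq_and_mem (ne_of_mem_erase hj).symm a (R j)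
  rw [hline, ← add_sum_erase univ _ (mem_univ i), hself, hother,
    ← add_sum_erase univ (fun j => #(R j)) (mem_univ i)]
  ring

lemma sum_hits (hA : IsOrthogonalArray t n A) (ht : 2 ≤ t) (R : Fin t → Finset (Fin n)) :
    ∑ x, hits A R x = n * ∑ i, #(R i) := by
  have h := sum_hits_mul_eq_sum_lines (A := A) (R := R) fun _ => 1
  simpa [hA.card_filter_eq ht, mul_sum, mul_comm] using h

lemma sum_hits_mul_hits_add (hA : IsOrthogonalArray t n A) (ht : 2 ≤ t)
    (R T : Fin t → Finset (Fin n)) :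
    ∑ x, hits A R x * hits A T x + ∑ i, #(R i) * #(T i) =
      n * ∑ i, #(R i ∩ T i) + (∑ i, #(R i)) * ∑ i, #(T i) := by
  have hfiber (i) : ∑ a ∈ R i, ∑ x with A i x = a, hits A T x + #(R i) * #(T i) =
      n * #(R i ∩ T i) + #(R i) * ∑ j, #(T j) := by
    rw [← smul_eq_mul #(R i), ← sum_const, ← sum_add_distrib]
    simp only [hA.sum_line_hits_add ht, sum_add_distrib, ← sum_filter, filter_mem_eq_inter,
      sum_const, smul_eq_mul, mul_comm]
  rw [sum_hits_mul_eq_sum_lines, ← sum_add_distrib, sum_congr rfl fun i _ => hfiber i,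
    sum_add_distrib, mul_sum, sum_mul]

lemma sum_hits_sub_mul_hits_sub (hA : IsOrthogonalArray t n A) (ht : 2 ≤ t)
    (R : Fin t → Finset (Fin n)) (a b : ℤ) :
    ∑ x, ((hits A R x : ℤ) - a) * (hits A R x - b) = a * b * n ^ 2 +
      (1 - a - b) * n * (∑ i, #(R i) : ℕ) + (∑ i, #(R i) : ℕ) ^ 2 - (∑ i, #(R i) ^ 2 : ℕ) := by
  have hfirst := hA.sum_hits ht R
  have hsecond := hA.sum_hits_mul_hits_add ht R R
  simp only [inter_self, ← sq] at hsecond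
  have hexpand (x) : ((hits A R x : ℤ) - a) * (hits A R x - b) =
      (hits A R x : ℤ) ^ 2 - (a + b) * hits A R x + a * b := by ring
  zify at hfirst hsecond
  simp only [hexpand, sum_add_distrib, sum_sub_distrib, ← mul_sum, hfirst, sum_const, card_univ,
    Fintype.card_fin, nsmul_eq_mul]
  push_cast
  linear_combination hsecond

lemma hits_entries_singleton (hA : IsOrthogonalArray t n A) (c x : Fin (n ^ 2)) :
    hits A (entries A {c}) x =
      (if x = c then t else 0) + if (orthogonalArrayGraph A).Adj c x then 1 else 0 := by
  by_cases hxc : x = c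
  · subst hxc
    simp [hits_entries_of_mem]
  by_cases hadj : (orthogonalArrayGraph A).Adj c x
  · obtain ⟨-, i, hi⟩ := id hadj
    have hunique (j) : A j x = A j c ↔ j = i :=
      ⟨fun hj => by_contra fun hji => hxc (hA j i hji (Prod.ext hj hi.symm)),
        fun hj => hj ▸ hi.symm⟩
    simp [hits, entries_singleton, hunique, hxc, hadj, filter_eq']
  · rw [hits_entries_eq_zero (by simpa using hxc) (by simpa using hadj)]
    simp [hxc, hadj]

lemma degree_add (hA : IsOrthogonalArray t n A) (ht : 2 ≤ t) (c : Fin (n ^ 2)) :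
    (orthogonalArrayGraph A).degree c + t = t * n := by
  have h := hA.sum_hits ht (entries A {c})
  simp only [hA.hits_entries_singleton, entries_singleton, sum_add_distrib, sum_ite_eq', mem_univ,
    if_true, sum_boole, Nat.cast_id, card_singleton, sum_const, card_univ, Fintype.card_fin,
    smul_eq_mul, mul_one] at h
  rw [← SimpleGraph.card_neighborFinset_eq_degree, SimpleGraph.neighborFinset_eq_filter]
  linarith

lemma sum_hits_entries_singleton_mul (hA : IsOrthogonalArray t n A) (hcd : c ≠ d) :
    ∑ x, hits A (entries A {c}) x * hits A (entries A {d}) x =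
      Fintype.card ((orthogonalArrayGraph A).commonNeighbors c d) +
        if (orthogonalArrayGraph A).Adj c d then 2 * t else 0 := by
  have hcommon : Fintype.card ((orthogonalArrayGraph A).commonNeighbors c d) =
      #{x | (orthogonalArrayGraph A).Adj c x ∧ (orthogonalArrayGraph A).Adj d x} := by
    rw [← Set.toFinset_card]
    congr 1
    ext x
    simp [SimpleGraph.mem_commonNeighbors]
  have hprod (x) : hits A (entries A {c}) x * hits A (entries A {d}) x =
      (if (orthogonalArrayGraph A).Adj c x ∧ (orthogonalArrayGraph A).Adj d x then 1 else 0) +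
        ((if x = c then if (orthogonalArrayGraph A).Adj c d then t else 0 else 0) +
          if x = d then if (orthogonalArrayGraph A).Adj c d then t else 0 else 0) := by
    rw [hA.hits_entries_singleton, hA.hits_entries_singleton]
    by_cases hxc : x = c
    · subst hxc
      simp [hcd, (orthogonalArrayGraph A).adj_comm d x]
    by_cases hxd : x = d
    · subst hxd
      simp [hcd.symm]
    simp [hxc, hxd, ← ite_and, and_comm]
  simp only [hprod, sum_add_distrib, sum_boole, sum_ite_eq', mem_univ, if_true, Nat.cast_id,
    hcommon]
  split_ifs <;> ring

lemma card_commonNeighbors (hA : IsOrthogonalArray t n A) (ht : 2 ≤ t) (hcd : c ≠ d) :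
    (Fintype.card ((orthogonalArrayGraph A).commonNeighbors c d) : ℤ) =
      t * (t - 1) + if (orthogonalArrayGraph A).Adj c d then (n - 2 * t : ℤ) else 0 := by
  have h := hA.sum_hits_mul_hits_add ht (entries A {c}) (entries A {d})
  have hinter : ∑ i, #(entries A {c} i ∩ entries A {d} i) =
      if (orthogonalArrayGraph A).Adj c d then 1 else 0 :=
    calc ∑ i, #(entries A {c} i ∩ entries A {d} i) = hits A (entries A {c}) d := by
          rw [hits, card_filter]
          refine sum_congr rfl fun i _ => ?_
          rw [entries_singleton A d, inter_singleton, apply_ite card, card_singleton, card_empty]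
      _ = if (orthogonalArrayGraph A).Adj c d then 1 else 0 := by
          rw [hA.hits_entries_singleton, if_neg hcd.symm, zero_add]
  rw [hA.sum_hits_entries_singleton_mul hcd, hinter] at h
  simp only [entries_singleton, card_singleton, sum_const, card_univ, Fintype.card_fin,
    smul_eq_mul, mul_one] at h
  zify at h
  split_ifs at h ⊢ <;> linarith

lemma isSRGWith (hA : IsOrthogonalArray t n A) (ht : 2 ≤ t) (hn : 2 ≤ n) :
    (orthogonalArrayGraph A).IsSRGWith (n ^ 2) (t * (n - 1)) (n - 2 + (t - 1) * (t - 2))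
      (t * (t - 1)) where
  card := Fintype.card_fin _
  regular c := by
    rw [Nat.mul_sub_one]
    exact Nat.eq_sub_of_add_eq (hA.degree_add ht c)
  of_adj c d h := by
    zify [ht, hn, show 1 ≤ t by omega]
    rw [hA.card_commonNeighbors ht h.ne, if_pos h]
    ring
  of_not_adj c d hne h := by
    zify [show 1 ≤ t by omega]
    rw [hA.card_commonNeighbors ht hne, if_neg h]
    ring

lemma connected (hA : IsOrthogonalArray t n A) (ht : 2 ≤ t) (hn : 2 ≤ n) :
    (orthogonalArrayGraph A).Connected := by
  have : NeZero (n ^ 2) := ⟨by positivity⟩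
  exact connected_of_isSRGWith (hA.isSRGWith ht hn)
    (Nat.mul_ne_zero (by omega) (by omega))

lemma card_farVertices (hA : IsOrthogonalArray t n A) (ht : 2 ≤ t) (hn : 2 ≤ n)
    (huv : (orthogonalArrayGraph A).Adj u v) :
    (#(farVertices (orthogonalArrayGraph A) u v) : ℤ) =
      n ^ 2 - (2 * t - 1) * n + t * (t - 1) := by
  have h := card_farVertices_add (hA.isSRGWith ht hn) huv
  zify [ht, hn, show 1 ≤ t by omega, show 1 ≤ n by omega] at h
  linear_combination h

lemma card_entries_pair (hA : IsOrthogonalArray t n A) (huv : u ≠ v) (hij : A i u = A i v) :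
    #(entries A {u, v} j) = if j = i then 1 else 2 := by
  rw [entries_insert, entries_singleton]
  split_ifs with hji
  · simp [hji, hij]
  · exact card_pair fun h => huv (hA j i hji (Prod.ext h hij))

lemma entryCount_pair_add_one (hA : IsOrthogonalArray t n A)
    (huv : (orthogonalArrayGraph A).Adj u v) : entryCount A {u, v} + 1 = 2 * t := by
  obtain ⟨hne, i, hi⟩ := huv
  rw [entryCount, ← add_sum_erase _ _ (mem_univ i), hA.card_entries_pair hne hi, if_pos rfl,
    sum_congr rfl fun j hj => by rw [hA.card_entries_pair hne hi, if_neg (ne_of_mem_erase hj)]]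
  have := i.pos
  simp only [sum_const, card_erase_of_mem (mem_univ i), card_univ, Fintype.card_fin, smul_eq_mul]
  omega

lemma hasNoIsolatedVertex_farVertices (hA : IsOrthogonalArray t n A) (ht : 2 ≤ t)
    (hn : 2 * t ≤ n + 1) (huv : (orthogonalArrayGraph A).Adj u v) :
    HasNoIsolatedVertex (orthogonalArrayGraph A) (farVertices (orthogonalArrayGraph A) u v) := by
  intro w hw
  obtain ⟨c, hc⟩ := huv.2
  have : Nontrivial (Fin t) := Fin.nontrivial_iff_two_le.2 ht
  obtain ⟨i, hi⟩ := exists_ne c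
  have hwi := hits_eq_zero_iff.1 ((mem_farVertices_iff_hits_eq_zero huv).1 hw) i
  have hsum := hA.sum_line_hits_add ht (entries A {u, v}) i (A i w)
  rw [if_neg hwi, hA.card_entries_pair huv.1 hc, if_neg hi, zero_add, ← entryCount] at hsum
  have hcount := hA.entryCount_pair_add_one huv
  have hmeet : #{x ∈ {x | A i x = A i w} | ¬ hits A (entries A {u, v}) x = 0} ≤
      ∑ x with A i x = A i w, hits A (entries A {u, v}) x := by
    rw [card_filter]
    gcongr with x
    split_ifs <;> omega
  have hline := card_filter_add_card_filter_not (s := {x | A i x = A i w})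
    fun x => hits A (entries A {u, v}) x = 0
  rw [hA.card_filter_eq ht] at hline
  have hfar : 1 < #{x ∈ {x | A i x = A i w} | hits A (entries A {u, v}) x = 0} := by omega
  obtain ⟨x, hx, hxw⟩ := exists_mem_ne hfar w
  simp only [mem_filter, mem_univ, true_and] at hx
  exact ⟨x, (mem_farVertices_iff_hits_eq_zero huv).2 hx.2, hxw.symm, i, hx.1.symm⟩

lemma exists_odd_hits (hA : IsOrthogonalArray t n A) (ht : 2 ≤ t) (hn : Even n)
    (hodd : Odd (∑ j, #(R j))) (hi : Even #(R i)) (a : Fin n) :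
    ∃ x, A i x = a ∧ Odd (hits A R x) := by
  by_contra! h
  have heven : Even (∑ x with A i x = a, hits A R x) :=
    even_sum _ fun x hx => Nat.not_odd_iff_even.1 (h x (mem_filter_univ x |>.1 hx))
  have hsum := hA.sum_line_hits_add ht R i a
  have hlhs := heven.add hi
  rw [hsum] at hlhs
  have hn' : Even (if a ∈ R i then n else 0) := by split_ifs <;> simp [hn]
  exact Nat.not_even_iff_odd.2 (hn'.add_odd hodd) hlhs

lemma le_card_odd_hits (hA : IsOrthogonalArray t n A) (ht : 2 ≤ t) (hn : Even n)
    (hodd : Odd (∑ j, #(R j))) (hi : Even #(R i)) : n ≤ #{x | Odd (hits A R x)} := by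
  have himage : image (A i) {x | Odd (hits A R x)} = univ := eq_univ_of_forall fun a => by
    obtain ⟨x, hx, hxodd⟩ := hA.exists_odd_hits ht hn hodd hi a
    exact mem_image.2 ⟨x, by simpa using hxodd, hx⟩
  simpa [himage] using card_image_le (s := {x | Odd (hits A R x)}) (f := A i)

lemma card_entries_triple (hA : IsOrthogonalArray t n A) (huv : u ≠ v) (hij : A i u = A i v)
    (hw : ∀ j, A j w ∉ entries A {u, v} j) :
    #(entries A {w, u, v} j) = if j = i then 2 else 3 := by
  rw [entries_insert, card_insert_of_notMem (hw j), hA.card_entries_pair huv hij]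
  split_ifs <;> rfl

lemma four_mul_card_add_card_odd_le {F : Finset (Fin (n ^ 2))}
    (hF : ∀ x ∈ F, hits A R x = 0 ∨ hits A R x = 4) :
    4 * (#F : ℤ) + #{x | Odd (hits A R x)} ≤ ∑ x, ((hits A R x : ℤ) - 2) * (hits A R x - 2) := by
  have hsum : 4 * (#F : ℤ) + #{x | Odd (hits A R x)} =
      ∑ x, ((if x ∈ F then 4 else 0) + if Odd (hits A R x) then 1 else 0) := by
    simp [sum_add_distrib, mul_comm]
  rw [hsum]
  refine sum_le_sum fun x _ => ?_
  split_ifs with hx hodd hodd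
  · rcases hF x hx with h | h <;> simp [h, Nat.odd_iff] at hodd
  · rcases hF x hx with h | h <;> simp [h]
  · have hne : (hits A R x : ℤ) - 2 ≠ 0 := fun h => by
      rw [show hits A R x = 2 by omega] at hodd
      exact absurd hodd (by decide)
    nlinarith [Int.one_le_abs hne, abs_mul_abs_self ((hits A R x : ℤ) - 2)]
  · nlinarith [sq_nonneg ((hits A R x : ℤ) - 2)]

/-- Only `n = 6` is needed. An `OA(4,6)` does not exist, but this parity argument is much shorter
than a proof of that. -/
lemma hasNoIsolatedVertex_farVertices_of_even {A : Matrix (Fin 4) (Fin (n ^ 2)) (Fin n)}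
    (hA : IsOrthogonalArray 4 n A) (hn : Even n) (hn6 : 6 ≤ n)
    (huv : (orthogonalArrayGraph A).Adj u v) :
    HasNoIsolatedVertex (orthogonalArrayGraph A) (farVertices (orthogonalArrayGraph A) u v) := by
  intro w hw
  by_contra! hiso
  obtain ⟨c, hc⟩ := huv.2
  have hwmem := hits_eq_zero_iff.1 ((mem_farVertices_iff_hits_eq_zero huv).1 hw)
  let R := entries A {w, u, v}
  have hR (j) : #(R j) = if j = c then 2 else 3 := hA.card_entries_triple huv.1 hc hwmem
  have hcount : ∑ j, #(R j) = 11 := by simp [hR, sum_ite, filter_eq', filter_ne']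
  have hcountSq : ∑ j, #(R j) ^ 2 = 31 := by simp [hR, sum_ite, filter_eq', filter_ne']
  let F := {u, v} ∪ farVertices (orthogonalArrayGraph A) u v
  have hF : ∀ x ∈ F, hits A R x = 0 ∨ hits A R x = 4 := by
    intro x hx
    by_cases hxR : x ∈ ({w, u, v} : Finset _)
    · exact .inr (hits_entries_of_mem hxR)
    have hxfar : x ∈ farVertices (orthogonalArrayGraph A) u v :=
      (mem_union.1 hx).resolve_left fun h => hxR (mem_insert_of_mem h)
    obtain ⟨hux, hvx⟩ := mem_farVertices.1 hxfar
    exact .inl (hits_entries_eq_zero hxR (by simp [hux, hvx, hiso x hxfar]))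
  have hcardF : #F = 2 + #(farVertices (orthogonalArrayGraph A) u v) := by
    rw [card_union_of_disjoint (by simp [mem_farVertices, huv, huv.symm]), card_pair huv.1]
  have hoddCount : n ≤ #{x | Odd (hits A R x)} :=
    hA.le_card_odd_hits (by norm_num) hn (by rw [hcount]; decide) (i := c) (by simp [hR])
  have hmoment := four_mul_card_add_card_odd_le hF
  rw [hA.sum_hits_sub_mul_hits_sub (by norm_num), hcount, hcountSq, hcardF] at hmoment
  have hfar := hA.card_farVertices (by norm_num) (by omega) huv
  push_cast at hmoment hfar
  zify at hoddCount hn6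
  linarith

lemma quadratic_bound_of_disjoint_entries (hA : IsOrthogonalArray t n A) (ht : 2 ≤ t)
    (hXY : ∀ i, Disjoint (entries A X i) (entries A Y i)) (a : ℤ) :
    t * ((t - a) * (t - a - 1) * #X + a * (a + 1) * #Y) ≤
      t * a * (a + 1) * n ^ 2 - 2 * a * t * n * entryCount A X +
        (t - 1) * (entryCount A X : ℤ) ^ 2 := by
  have hX {x} (hx : x ∈ X) : hits A (entries A X) x = t := hits_entries_of_mem hx
  have hY {y} (hy : y ∈ Y) : hits A (entries A X) y = 0 := hits_eq_zero_iff.2 fun i =>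
    disjoint_right.1 (hXY i) (mem_entries_of_mem hy i)
  have hmoment : (t - a) * (t - a - 1) * #X + a * (a + 1) * #Y ≤
      ∑ x, ((hits A (entries A X) x : ℤ) - a) * (hits A (entries A X) x - (a + 1)) :=
    calc (t - a) * (t - a - 1) * #X + a * (a + 1) * #Y
        = ∑ x, ((if x ∈ X then (t - a) * (t - a - 1) else 0) +
            if x ∈ Y then a * (a + 1) else 0) := by simp [sum_add_distrib, mul_comm]
      _ ≤ _ := by
        refine sum_le_sum fun x _ => ?_
        split_ifs with hxX hxY hxY
        · have := hX hxX
          have := hY hxY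
          omega
        · rw [hX hxX]
          linarith
        · rw [hY hxY]
          push_cast
          linarith
        · -- no integer lies strictly between `a` and `a + 1`
          rcases le_or_gt (hits A (entries A X) x : ℤ) a with h | h <;> nlinarith
  rw [hA.sum_hits_sub_mul_hits_sub ht, ← entryCount] at hmoment
  have hsq := entryCount_sq_le A X
  zify at hsq
  have := mul_le_mul_of_nonneg_left hmoment (Nat.cast_nonneg (α := ℤ) t)
  push_cast at this
  linarith

end IsOrthogonalArray

namespace IsSplit

variable {t n : ℕ} {A : Matrix (Fin t) (Fin (n ^ 2)) (Fin n)} {X Y : Finset (Fin (n ^ 2))}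
  {u v : Fin (n ^ 2)}

lemma two_mul_le_entryCount_left_add_one (h : IsSplit (orthogonalArrayGraph A) X Y)
    (hA : IsOrthogonalArray t n A) : 2 * t ≤ entryCount A X + 1 := by
  obtain ⟨u, hu, v, hv, huv⟩ := h.exists_adj_left
  rw [← hA.entryCount_pair_add_one huv]
  gcongr
  exact entryCount_mono (insert_subset hu (singleton_subset_iff.2 hv))

lemma entryCount_left_add_two_mul_le (h : IsSplit (orthogonalArrayGraph A) X Y)
    (hA : IsOrthogonalArray t n A) : entryCount A X + 2 * t ≤ t * n + 1 := by
  have hY := h.symm.two_mul_le_entryCount_left_add_one hA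
  have hsum := entryCount_add_entryCount_le h.disjoint_entries
  omega

lemma card_add_card_le_of_two_rows {A : Matrix (Fin 2) (Fin (n ^ 2)) (Fin n)}
    (h : IsSplit (orthogonalArrayGraph A) X Y) (hA : IsOrthogonalArray 2 n A) :
    (#X + #Y : ℤ) ≤ n ^ 2 - 3 * n + 4 := by
  have h₀ := hA.quadratic_bound_of_disjoint_entries le_rfl h.disjoint_entries 0
  have h₁ := hA.quadratic_bound_of_disjoint_entries le_rfl h.disjoint_entries 1
  have hlower := h.two_mul_le_entryCount_left_add_one hA
  have hupper := h.entryCount_left_add_two_mul_le hA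
  zify at hlower hupper
  generalize (entryCount A X : ℤ) = e at *
  have hconcave : 0 ≤ (e - 3) * (2 * n - 3 - e) := mul_nonneg (by linarith) (by linarith)
  refine Int.lt_add_one_iff.1 (lt_of_mul_lt_mul_left ?_ (by norm_num : (0 : ℤ) ≤ 4))
  push_cast at h₀ h₁
  linarith

lemma card_add_card_le_of_three_rows {A : Matrix (Fin 3) (Fin (n ^ 2)) (Fin n)}
    (h : IsSplit (orthogonalArrayGraph A) X Y) (hA : IsOrthogonalArray 3 n A) :
    (#X + #Y : ℤ) ≤ n ^ 2 - 5 * n + 8 := by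
  have h₁ := hA.quadratic_bound_of_disjoint_entries (by norm_num) h.disjoint_entries 1
  have hlower := h.two_mul_le_entryCount_left_add_one hA
  have hupper := h.entryCount_left_add_two_mul_le hA
  zify at hlower hupper
  generalize (entryCount A X : ℤ) = e at *
  have hconcave : 0 ≤ (e - 5) * (3 * n - 5 - e) := mul_nonneg (by linarith) (by linarith)
  refine Int.lt_add_one_iff.1 (lt_of_mul_lt_mul_left ?_ (by norm_num : (0 : ℤ) ≤ 6))
  push_cast at h₁
  linarith

section FourRows

variable {A : Matrix (Fin 4) (Fin (n ^ 2)) (Fin n)}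

lemma card_add_card_le_of_four_rows_of_le_five
    (h : IsSplit (orthogonalArrayGraph A) X Y) (hA : IsOrthogonalArray 4 n A) (hn : n ≤ 5) :
    (#X + #Y : ℤ) ≤ n ^ 2 - 7 * n + 14 := by
  have hlower := h.two_mul_le_entryCount_left_add_one hA
  have hupper := h.entryCount_left_add_two_mul_le hA
  have hright {X Y} (h : IsSplit (orthogonalArrayGraph A) X Y) :
      (#Y : ℤ) ≤ n ^ 2 - 7 * n + 12 := by
    obtain ⟨u, hu, v, hv, huv⟩ := h.exists_adj_left
    have hfar := hA.card_farVertices (by norm_num) (by omega) huv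
    have hle := card_le_card (h.right_subset_farVertices hu hv)
    push_cast at hfar
    omega
  have hX := hright h.symm
  have hY := hright h
  have hroots : 0 ≤ ((n : ℤ) - 2) * (5 - n) := mul_nonneg (by omega) (by omega)
  linarith

lemma card_add_card_le_of_four_rows_of_few_entries
    (h : IsSplit (orthogonalArrayGraph A) X Y) (hA : IsOrthogonalArray 4 n A) (hn : 6 ≤ n)
    (he : entryCount A X ≤ 11) :
    (#X + #Y : ℤ) ≤ n ^ 2 - 7 * n + 14 := by
  have h₁ := hA.quadratic_bound_of_disjoint_entries (by norm_num) h.disjoint_entries 1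
  have hlower := h.two_mul_le_entryCount_left_add_one hA
  have hX := h.noIsolated_left.two_mul_entryCount_add_card_le
  have hcard : 6 * entryCount A X ≤ 16 * #X + 14 := by omega
  zify at hlower he hn hcard
  generalize (entryCount A X : ℤ) = e at *
  have hconcave : 0 ≤ (e - 7) * (11 - e) := mul_nonneg (by linarith) (by linarith)
  have hproduct : 0 ≤ ((n : ℤ) - 6) * (e - 7) := mul_nonneg (by linarith) (by linarith)
  refine Int.lt_add_one_iff.1 (lt_of_mul_lt_mul_left ?_ (by norm_num : (0 : ℤ) ≤ 8))
  push_cast at h₁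
  linarith

lemma card_add_card_le_of_four_rows_of_many_entries
    (h : IsSplit (orthogonalArrayGraph A) X Y) (hA : IsOrthogonalArray 4 n A) (hn : 6 ≤ n)
    (he : 12 ≤ entryCount A X) (he' : entryCount A X ≤ 2 * n) :
    (#X + #Y : ℤ) ≤ n ^ 2 - 7 * n + 14 := by
  have h₁ := hA.quadratic_bound_of_disjoint_entries (by norm_num) h.disjoint_entries 1
  have h₂ := hA.quadratic_bound_of_disjoint_entries (by norm_num) h.disjoint_entries 2
  obtain rfl | hn7 := hn.eq_or_lt
  · have heq : entryCount A X = 12 := by omega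
    rw [heq] at h₁ h₂
    push_cast at h₁ h₂ ⊢
    omega
  zify at he he' hn7
  generalize (entryCount A X : ℤ) = e at *
  have hconcave : 0 ≤ (e - 12) * (2 * n - e) := mul_nonneg (by linarith) (by linarith)
  have hproduct : 0 ≤ ((n : ℤ) - 6) * (e - 12) := mul_nonneg (by linarith) (by linarith)
  refine Int.lt_add_one_iff.1 (lt_of_mul_lt_mul_left ?_ (by norm_num : (0 : ℤ) ≤ 16))
  push_cast at h₁ h₂
  linarith

lemma card_add_card_le_of_four_rows
    (h : IsSplit (orthogonalArrayGraph A) X Y) (hA : IsOrthogonalArray 4 n A) :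
    (#X + #Y : ℤ) ≤ n ^ 2 - 7 * n + 14 := by
  rcases le_or_gt n 5 with hn | hn
  · exact h.card_add_card_le_of_four_rows_of_le_five hA hn
  wlog he : entryCount A X ≤ 2 * n generalizing X Y
  · have hsum := entryCount_add_entryCount_le h.disjoint_entries
    rw [add_comm]
    exact this h.symm (by omega)
  rcases le_or_gt (entryCount A X) 11 with he' | he'
  · exact h.card_add_card_le_of_four_rows_of_few_entries hA hn he'
  · exact h.card_add_card_le_of_four_rows_of_many_entries hA hn he' he

end FourRows

lemma card_add_card_le (h : IsSplit (orthogonalArrayGraph A) X Y)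
    (hA : IsOrthogonalArray t n A) (ht : 2 ≤ t) (ht4 : t ≤ 4) (hn : 2 ≤ n)
    (huv : (orthogonalArrayGraph A).Adj u v) :
    #X + #Y ≤ #(farVertices (orthogonalArrayGraph A) u v) + 2 := by
  have hfar := hA.card_farVertices ht hn huv
  zify
  rw [hfar]
  interval_cases t
  · push_cast
    linarith [h.card_add_card_le_of_two_rows hA]
  · push_cast
    linarith [h.card_add_card_le_of_three_rows hA]
  · push_cast
    linarith [h.card_add_card_le_of_four_rows hA]

lemma hasNoIsolatedVertex_farVertices (h : IsSplit (orthogonalArrayGraph A) X Y)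
    (hA : IsOrthogonalArray t n A) (ht : 2 ≤ t) (ht4 : t ≤ 4) (hu : u ∈ X) (hv : v ∈ X)
    (huv : (orthogonalArrayGraph A).Adj u v) :
    HasNoIsolatedVertex (orthogonalArrayGraph A)
      (farVertices (orthogonalArrayGraph A) u v) := by
  rcases le_or_gt (2 * t) (n + 1) with hn | hn
  · exact hA.hasNoIsolatedVertex_farVertices ht hn huv
  by_cases h46 : t = 4 ∧ n = 6
  · obtain ⟨rfl, rfl⟩ := h46
    exact hA.hasNoIsolatedVertex_farVertices_of_even (by decide) le_rfl huv
  have hlower := h.two_mul_le_entryCount_left_add_one hA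
  have hupper := h.entryCount_left_add_two_mul_le hA
  have hsmall : #(farVertices (orthogonalArrayGraph A) u v) ≤ 2 := by
    have hfar := hA.card_farVertices ht (by interval_cases t <;> omega) huv
    have hn7 : n ≤ 6 := by omega
    zify
    interval_cases t <;> interval_cases n <;> omega
  have hY : Y = farVertices (orthogonalArrayGraph A) u v :=
    eq_of_subset_of_card_le (h.right_subset_farVertices hu hv)
      (hsmall.trans h.symm.two_le_card_left)
  exact hY ▸ h.noIsolated_right

lemma exists_adj_isSplit_farVertices (h : IsSplit (orthogonalArrayGraph A) X Y)
    (hA : IsOrthogonalArray t n A) (ht : 2 ≤ t) (ht4 : t ≤ 4) :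
    ∃ u v, (orthogonalArrayGraph A).Adj u v ∧
      IsSplit (orthogonalArrayGraph A) {u, v} (farVertices (orthogonalArrayGraph A) u v) := by
  obtain ⟨u, hu, v, hv, huv⟩ := h.exists_adj_left
  exact ⟨u, v, huv, isSplit_pair_farVertices huv
    (h.nonempty_right.mono (h.right_subset_farVertices hu hv))
    (h.hasNoIsolatedVertex_farVertices hA ht ht4 hu hv huv)⟩

end IsSplit

theorem mainTheorem5_general (t n : ℕ) (ht : 2 ≤ t) (ht4 : t ≤ 4) (hn : 2 ≤ n)
    (A : Matrix (Fin t) (Fin (n ^ 2)) (Fin n)) (hA : IsOrthogonalArray t n A) :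
    SatisfiesBrouwerConjecture (orthogonalArrayGraph A)
      (n ^ 2) (t * (n - 1)) (n - 2 + (t - 1) * (t - 2)) (t * (t - 1)) :=
  satisfiesBrouwerConjecture_of_isSplit_bounds (hA.isSRGWith ht hn) (hA.connected ht hn)
    (fun _ _ _ _ h huv => h.card_add_card_le hA ht ht4 hn huv)
    fun _ _ h => h.exists_adj_isSplit_farVertices hA ht ht4

theorem mainTheorem5 (t n : ℕ) (ht : t = 3 ∨ t = 4) (hn : t ≤ n)
    (A : Matrix (Fin t) (Fin (n ^ 2)) (Fin n)) (hA : IsOrthogonalArray t n A) :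
    SatisfiesBrouwerConjecture (orthogonalArrayGraph A)
      (n ^ 2) (t * (n - 1)) (n - 2 + (t - 1) * (t - 2)) (t * (t - 1)) :=
  mainTheorem5_general t n (by omega) (by omega) (by omega) A hA
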